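/- Let $N\ge 1$ and write a (not necessarily normalized) state $\psi\in(\mathbb{C}^{d})^{\otimes N}$ in the product basis $|i_1,\dots,i_N\rangle$. Let $A_1,\dots,A_d$ be complex $D\times D$ matrices and let $\mathcal{E}(X)=\sum_i A_iXA_i^\dagger$. Assume that (1) $\sum_i A_iA_i^\dagger=\mathbb{1}$; (2) $\sum_i A_i^\dagger\Lambda A_i=\Lambda$ for some diagonal matrix $\Lambda$ with strictly positive diagonal entries; (3) $\mathbb{1}$ is, up to scalar multiples, the only fixed point of $\mathcal{E}$. Let $0<\lambda\le 1$ and let $$\psi=\sum_{i_1,\dots,i_N}\operatorname{tr}\big[(\lambda A_{i_1})\cdots(\lambda A_{i_N})\big]\,|i_1,\dots,i_N\rangle ,$$ i.e. $\psi$ is a translationally invariant state whose canonical form has the single block $A$. Let $p$ be the number of (distinct) eigenvalues of $\mathcal{E}$ of modulus one. (a) If $p$ divides $N$, then $\psi=\sum_{k=0}^{p-1}\psi_k$, where each $\psi_k\in(\mathbb{C}^{d})^{\otimes N}$ is $p$-periodic (invariant under translation of the ring by $p$ sites) and is a matrix product state of bond dimension $D$, i.e. of the form $\sum_{i_1,\dots,i_N}\operatorname{tr}[B^{[1]}_{i_1}\cdots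 B^{[N]}_{i_N}]\,|i_1,\dots,i_N\rangle$ with $D\times D$ matrices. More precisely, there are nonzero, mutually orthogonal, orthogonal projections $P_0,\dots,P_{p-1}$ on $\mathbb{C}^D$ with $\sum_kP_k=\mathbb{1}$ and $A_iP_{k+1}=P_kA_i$ for all $i,k$ (indices of $P$ modulo $p$), such that $\psi_k$ is the matrix product state with the site-dependent matrices $B^{[j]}_{i}=P_{k+j-1}(\lambda A_{i})P_{k+j}$, $j=1,\dots,N$. (b) If $p$ does not divide $N$, then $\psi=0$. -/

import Mathlib

open scoped Matrix

noncomputable section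

namespace MPS

/-- (Unnormalized) pure states of a ring of `N` sites of local dimension `d`. The coefficient of
`ψ` at the product basis vector `|i₁,…,i_N⟩` is `ψ i`. -/
abbrev State (d N : ℕ) : Type := EuclideanSpace ℂ (Fin N → Fin d)

/-- A tensor: one `D × D` matrix for each of the `d` basis vectors of a site. -/
abbrev Tensor (d D : ℕ) : Type := Fin d → Matrix (Fin D) (Fin D) ℂ

/-- The matrix product state `∑ tr(A^[1]_{i₁} ⋯ A^[N]_{i_N}) |i₁,…,i_N⟩` with (possibly
site-dependent) `D × D` matrices. -/
def mps {d D N : ℕ} (A : Fin N → Tensor d D) : State d N :=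
  WithLp.toLp 2 fun i => Matrix.trace (List.ofFn fun j => A j (i j)).prod

/-- The translationally invariant matrix product state with site-independent matrices `A i`. -/
def tiMPS {d D : ℕ} (N : ℕ) (A : Tensor d D) : State d N :=
  mps fun _ => A

/-- `ψ` has a matrix product representation with bond dimension `D`. -/
def HasMPSRepresentation {d N : ℕ} (D : ℕ) (ψ : State d N) : Prop :=
  ∃ B : Fin N → Tensor d D, ψ = mps B

/-- The translation `τ (x₁ ⊗ ⋯ ⊗ x_N) = x₂ ⊗ ⋯ ⊗ x_N ⊗ x₁` with periodic boundary conditions. -/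
def translation {d N : ℕ} (ψ : State d N) : State d N :=
  WithLp.toLp 2 fun i => ψ fun j => i ((finRotate N).symm j)

/-- A state is `p`-periodic if it is invariant under translation by `p` sites. -/
def IsPeriodicState {d N : ℕ} (p : ℕ) (ψ : State d N) : Prop :=
  translation^[p] ψ = ψ

/-- The completely positive map `X ↦ ∑ i, A_i X A_i†`. -/
def cpMap {d D : ℕ} (A : Tensor d D) :
    Matrix (Fin D) (Fin D) ℂ →ₗ[ℂ] Matrix (Fin D) (Fin D) ℂ where
  toFun X := ∑ i, A i * X * (A i)ᴴ
  map_add' X Y := by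
    simp only [mul_add, add_mul, Finset.sum_add_distrib]
  map_smul' c X := by
    simp only [Matrix.mul_smul, Matrix.smul_mul, Finset.smul_sum, RingHom.id_apply]

/-- The conditions on a single block of the canonical form of a translationally invariant
matrix product state. "The only fixed point" is understood up to scalar multiples. -/
structure IsCanonicalBlock {d D : ℕ} (A : Tensor d D) : Prop where
  unital : ∑ i, A i * (A i)ᴴ = 1
  dual_fixed : ∃ L : Fin D → ℝ, (∀ a, 0 < L a) ∧
    ∑ i, (A i)ᴴ * Matrix.diagonal (fun a => (L a : ℂ)) * A i =
      Matrix.diagonal (fun a => (L a : ℂ))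
  fixed_unique : ∀ X, cpMap A X = X → ∃ c : ℂ, X = c • 1

/-- The set of eigenvalues of modulus one of the completely positive map of `A`. -/
def peripheralEigenvalues {d D : ℕ} (A : Tensor d D) : Set ℂ :=
  {μ | Module.End.HasEigenvalue (cpMap A) μ ∧ ‖μ‖ = 1}

/-- `P 0, …, P (p - 1)` are nonzero, mutually orthogonal, orthogonal projections that sum to the
identity (and `P` is continued `p`-periodically), and they are cyclically permuted by the
matrices of `A`, in the sense that `A_i P_{k+1} = P_k A_i`. -/
structure IsCyclicDecomposition {d D : ℕ} (A : Tensor d D) (p : ℕ)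
    (P : ℕ → Matrix (Fin D) (Fin D) ℂ) : Prop where
  periodic : ∀ k, P (k + p) = P k
  hermitian : ∀ k, (P k).IsHermitian
  idempotent : ∀ k, P k * P k = P k
  ne_zero : ∀ k, P k ≠ 0
  orthogonal : ∀ k < p, ∀ l < p, k ≠ l → P k * P l = 0
  sum_eq_one : ∑ k ∈ Finset.range p, P k = 1
  shift : ∀ i k, A i * P (k + 1) = P k * A i

end MPS

end

open scoped Matrix

namespace MPS

variable {d D : ℕ} {A : Tensor d D}

/-! An eigenvector `X` of modulus-one eigenvalue `μ` gives equality in the Schwarz inequality,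
because the faithful functional `tr (Λ ·)` is invariant. Equality forces `X * (A i)ᴴ = μ • ((A i)ᴴ *
X)` and makes `Xᴴ * X` a fixed point, hence scalar; rescaled, `X` is a unitary `U` with `A i * U = μ
• (U * A i)` (`isTwistedSymmetry_of_cpMap_eq`). Such phases form a finite, hence cyclic, group of
order `p` with generator `ω`, and its unitary can be normalized to `U ^ p = 1`. The spectral
projections of `U` are then shifted cyclically by the `A i`. Inserting `∑ P k = 1` in the trace
splits the state, and translating one site raises `k` by one. Conjugating the trace by `U`
multiplies it by `ω ^ N`, so it vanishes unless `p ∣ N`. -/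

theorem cpMap_apply (A : Tensor d D) (X : Matrix (Fin D) (Fin D) ℂ) :
    cpMap A X = ∑ i, A i * X * (A i)ᴴ := rfl

/-! ### Invariant faithful weight and the Schwarz defect -/

theorem trace_diagonal_mul_conjTranspose_mul_self (L : Fin D → ℝ)
    (C : Matrix (Fin D) (Fin D) ℂ) :
    Matrix.trace (Matrix.diagonal (fun a => (L a : ℂ)) * (Cᴴ * C)) =
      ((∑ a, L a * ∑ b, ‖C b a‖ ^ 2 : ℝ) : ℂ) := by
  simp only [Matrix.trace, Matrix.diag]
  push_cast
  refine Finset.sum_congr rfl fun a _ => ?_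
  rw [Matrix.diagonal_mul, Matrix.mul_apply]
  congr 1
  refine Finset.sum_congr rfl fun b _ => ?_
  rw [← Complex.conj_mul']
  rfl

/-- The trace is a sum of squared moduli of entries with strictly positive weights. This
faithfulness turns a Schwarz defect of zero weight into operator identities. -/
theorem eq_zero_of_trace_diagonal_sum_eq_zero {L : Fin D → ℝ} (hL : ∀ a, 0 < L a)
    {C : Fin d → Matrix (Fin D) (Fin D) ℂ}
    (h : Matrix.trace (Matrix.diagonal (fun a => (L a : ℂ)) * ∑ i, (C i)ᴴ * C i) = 0)
    (i : Fin d) : C i = 0 := by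
  rw [Finset.mul_sum, Matrix.trace_sum] at h
  simp only [trace_diagonal_mul_conjTranspose_mul_self] at h
  have h' : ∑ i, ∑ a, L a * ∑ b, ‖C i b a‖ ^ 2 = 0 := by exact_mod_cast h
  have hnn : ∀ i a, 0 ≤ L a * ∑ b, ‖C i b a‖ ^ 2 := fun i a =>
    mul_nonneg (hL a).le (Finset.sum_nonneg fun b _ => by positivity)
  have h1 := (Finset.sum_eq_zero_iff_of_nonneg
    (fun i _ => Finset.sum_nonneg fun a _ => hnn i a)).1 h' i (Finset.mem_univ _)
  ext b a
  have h2 := (Finset.sum_eq_zero_iff_of_nonneg (fun a _ => hnn i a)).1 h1 a (Finset.mem_univ _)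
  have h3 := (mul_eq_zero.1 h2).resolve_left (hL a).ne'
  have h4 := (Finset.sum_eq_zero_iff_of_nonneg (fun b _ => by positivity)).1 h3 b
    (Finset.mem_univ _)
  simpa using h4

theorem trace_mul_cpMap (A : Tensor d D) (L X : Matrix (Fin D) (Fin D) ℂ) :
    Matrix.trace (L * cpMap A X) = Matrix.trace ((∑ i, (A i)ᴴ * L * A i) * X) := by
  simp only [cpMap_apply, Finset.mul_sum, Finset.sum_mul, Matrix.trace_sum]
  refine Finset.sum_congr rfl fun i _ => ?_
  rw [← mul_assoc, Matrix.trace_mul_comm]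
  simp only [mul_assoc]

theorem conjTranspose_cpMap (A : Tensor d D) (X : Matrix (Fin D) (Fin D) ℂ) :
    (cpMap A X)ᴴ = cpMap A Xᴴ := by
  simp [cpMap_apply, Matrix.conjTranspose_sum, mul_assoc]

/-- The defect in the Schwarz inequality for a unital completely positive map. -/
theorem sum_conjTranspose_mul_self_eq (hA : ∑ i, A i * (A i)ᴴ = 1)
    (X : Matrix (Fin D) (Fin D) ℂ) :
    ∑ i, (X * (A i)ᴴ - (A i)ᴴ * cpMap A X)ᴴ * (X * (A i)ᴴ - (A i)ᴴ * cpMap A X) =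
      cpMap A (Xᴴ * X) - (cpMap A X)ᴴ * cpMap A X := by
  set Y := cpMap A X with hY
  have e : ∀ i, (X * (A i)ᴴ - (A i)ᴴ * Y)ᴴ * (X * (A i)ᴴ - (A i)ᴴ * Y) =
      A i * (Xᴴ * X) * (A i)ᴴ - (A i * Xᴴ * (A i)ᴴ) * Y - Yᴴ * (A i * X * (A i)ᴴ)
        + Yᴴ * (A i * (A i)ᴴ) * Y := by
    intro i
    simp only [Matrix.conjTranspose_sub, Matrix.conjTranspose_mul,
      Matrix.conjTranspose_conjTranspose]
    noncomm_ring
  simp only [e, Finset.sum_add_distrib, Finset.sum_sub_distrib, ← Finset.sum_mul,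
    ← Finset.mul_sum, hA]
  rw [← cpMap_apply, ← cpMap_apply, ← cpMap_apply, ← conjTranspose_cpMap, ← hY]
  noncomm_ring

/-! ### Twisted symmetries and peripheral eigenvalues -/

/-- `U` is a unitary that commutes with all matrices of `A` up to the phase `μ`. -/
structure IsTwistedSymmetry (A : Tensor d D) (μ : ℂ) (U : Matrix (Fin D) (Fin D) ℂ) : Prop where
  mem_unitary : U ∈ unitary (Matrix (Fin D) (Fin D) ℂ)
  comm : ∀ i, A i * U = μ • (U * A i)

theorem IsTwistedSymmetry.one (A : Tensor d D) : IsTwistedSymmetry A 1 1 :=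
  ⟨one_mem _, fun i => by simp⟩

theorem IsTwistedSymmetry.mul {μ ν : ℂ} {U V : Matrix (Fin D) (Fin D) ℂ}
    (hU : IsTwistedSymmetry A μ U) (hV : IsTwistedSymmetry A ν V) :
    IsTwistedSymmetry A (μ * ν) (U * V) :=
  ⟨mul_mem hU.mem_unitary hV.mem_unitary, fun i => by
    rw [← mul_assoc, hU.comm, Matrix.smul_mul, mul_assoc, hV.comm, Matrix.mul_smul, smul_smul,
      mul_assoc]⟩

theorem IsTwistedSymmetry.pow {μ : ℂ} {U : Matrix (Fin D) (Fin D) ℂ}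
    (hU : IsTwistedSymmetry A μ U) (n : ℕ) : IsTwistedSymmetry A (μ ^ n) (U ^ n) := by
  induction n with
  | zero => simpa using IsTwistedSymmetry.one A
  | succ n ih => simpa only [pow_succ] using ih.mul hU

theorem IsTwistedSymmetry.inv {μ : ℂ} (hμ : μ ≠ 0) {U : Matrix (Fin D) (Fin D) ℂ}
    (hU : IsTwistedSymmetry A μ U) : IsTwistedSymmetry A μ⁻¹ (star U) := by
  refine ⟨Unitary.star_mem hU.mem_unitary, fun i => ?_⟩
  have h1 := Unitary.star_mul_self_of_mem hU.mem_unitary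
  have h2 := Unitary.mul_star_self_of_mem hU.mem_unitary
  calc A i * star U = μ⁻¹ • (star U * (μ • (U * A i)) * star U) := by
        rw [Matrix.mul_smul, Matrix.smul_mul, smul_smul, inv_mul_cancel₀ hμ, one_smul,
          ← mul_assoc, h1, one_mul]
    _ = μ⁻¹ • (star U * A i) := by
        rw [← hU.comm, mul_assoc, mul_assoc, h2, mul_one]

theorem IsTwistedSymmetry.cpMap_eq {μ : ℂ} {U : Matrix (Fin D) (Fin D) ℂ}
    (hU : IsTwistedSymmetry A μ U) (hA : ∑ i, A i * (A i)ᴴ = 1) : cpMap A U = μ • U := by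
  simp only [cpMap_apply, hU.comm, Matrix.smul_mul, mul_assoc]
  rw [← Finset.smul_sum, ← Finset.mul_sum, hA, mul_one]

/-- Since `‖μ‖ = 1`, the Schwarz defect of `X` is `cpMap A (Xᴴ * X) - Xᴴ * X`, which the invariant
weight annihilates, so every summand of the defect vanishes. -/
theorem isTwistedSymmetry_of_cpMap_eq (hA : IsCanonicalBlock A) {μ : ℂ} (hμ : ‖μ‖ = 1)
    {X : Matrix (Fin D) (Fin D) ℂ} (hX : cpMap A X = μ • X) (hX0 : X ≠ 0) :
    ∃ U, IsTwistedSymmetry A μ U := by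
  obtain ⟨L, hL, hfix⟩ := hA.dual_fixed
  have hμμ : star μ * μ = 1 := by
    rw [Complex.star_def, Complex.conj_mul', hμ]; simp
  have hdefect := sum_conjTranspose_mul_self_eq hA.unital X
  have hYY : (cpMap A X)ᴴ * cpMap A X = Xᴴ * X := by
    rw [hX, Matrix.conjTranspose_smul, Matrix.smul_mul, Matrix.mul_smul, smul_smul, hμμ, one_smul]
  rw [hYY] at hdefect
  have hC : ∀ i, X * (A i)ᴴ - (A i)ᴴ * cpMap A X = 0 := by
    refine eq_zero_of_trace_diagonal_sum_eq_zero hL ?_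
    rw [hdefect, mul_sub, Matrix.trace_sub, trace_mul_cpMap, hfix, sub_self]
  have hfixed : cpMap A (Xᴴ * X) = Xᴴ * X := by
    simp only [hC, mul_zero, Finset.sum_const_zero] at hdefect
    exact (sub_eq_zero.1 hdefect.symm)
  obtain ⟨c, hc⟩ := hA.fixed_unique _ hfixed
  -- The scalar `c` is the squared norm of any column of `X`; a nonzero column shows that it is
  -- positive.
  obtain ⟨b, a, hba⟩ : ∃ b a, X b a ≠ 0 := by
    by_contra! h
    exact hX0 (by ext b a; simpa using h b a)
  set r : ℝ := ∑ b, ‖X b a‖ ^ 2 with hr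
  have hcr : c = r := by
    have := congrFun (congrFun hc a) a
    simp only [Matrix.mul_apply, Matrix.conjTranspose_apply, Matrix.smul_apply, Matrix.one_apply_eq,
      smul_eq_mul, mul_one] at this
    rw [← this, hr]
    push_cast
    refine Finset.sum_congr rfl fun b _ => ?_
    rw [← Complex.conj_mul']
    rfl
  have hrpos : 0 < r := Finset.sum_pos' (fun b _ => by positivity)
    ⟨b, Finset.mem_univ _, by have := norm_pos_iff.2 hba; positivity⟩
  set s : ℂ := (((Real.sqrt r)⁻¹ : ℝ) : ℂ) with hs
  have hss : star s * s * c = 1 := by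
    rw [hcr, hs, Complex.star_def, Complex.conj_ofReal]
    norm_cast
    rw [← mul_inv, Real.mul_self_sqrt hrpos.le, inv_mul_cancel₀ hrpos.ne']
  have hU : star (s • X) * (s • X) = 1 := by
    rw [Matrix.star_eq_conjTranspose, Matrix.conjTranspose_smul, Matrix.smul_mul, Matrix.mul_smul,
      smul_smul, hc, smul_smul, hss, one_smul]
  have hUmem : s • X ∈ unitary (Matrix (Fin D) (Fin D) ℂ) :=
    Matrix.mem_unitaryGroup_iff'.2 hU
  have hU' := Unitary.mul_star_self_of_mem hUmem
  refine ⟨s • X, hUmem, fun i => ?_⟩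
  have h1 : (s • X) * (A i)ᴴ = μ • ((A i)ᴴ * (s • X)) := by
    have := sub_eq_zero.1 (hC i)
    rw [hX, Matrix.mul_smul] at this
    rw [Matrix.smul_mul, this, Matrix.mul_smul, smul_comm]
  -- The vanishing defect concerns `(A i)ᴴ`; taking adjoints and then conjugating by the unitary
  -- yields the relation for `A i` itself.
  have h2 : A i * star (s • X) = star μ • (star (s • X) * A i) := by
    have := congrArg Matrix.conjTranspose h1
    simpa only [Matrix.conjTranspose_mul, Matrix.conjTranspose_smul,
      Matrix.conjTranspose_conjTranspose, Matrix.star_eq_conjTranspose] using this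
  generalize s • X = U at *
  have h3 : star μ • (A i * U) = U * A i := by
    calc star μ • (A i * U) = U * (star μ • (star U * A i)) * U := by
          rw [Matrix.mul_smul, ← mul_assoc, hU', one_mul, Matrix.smul_mul]
      _ = U * A i := by rw [← h2, mul_assoc, mul_assoc, hU, mul_one]
  rw [← h3, smul_smul, mul_comm μ, hμμ, one_smul]

theorem mem_peripheralEigenvalues_iff [NeZero D] (hA : IsCanonicalBlock A) {μ : ℂ} :
    μ ∈ peripheralEigenvalues A ↔ ‖μ‖ = 1 ∧ ∃ U, IsTwistedSymmetry A μ U := by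
  constructor
  · rintro ⟨he, hμ⟩
    obtain ⟨X, hX⟩ := he.exists_hasEigenvector
    exact ⟨hμ, isTwistedSymmetry_of_cpMap_eq hA hμ hX.apply_eq_smul hX.2⟩
  · rintro ⟨hμ, U, hU⟩
    refine ⟨Module.End.hasEigenvalue_of_hasEigenvector (x := U)
      (Module.End.hasEigenvector_iff.2 ⟨Module.End.mem_eigenspace_iff.2 (hU.cpMap_eq hA.unital), ?_⟩),
      hμ⟩
    rintro rfl
    simpa using Unitary.star_mul_self_of_mem hU.mem_unitary

theorem finite_peripheralEigenvalues (A : Tensor d D) : (peripheralEigenvalues A).Finite :=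
  (Module.End.finite_hasEigenvalue (cpMap A)).subset fun _ h => h.1

/-! ### The cyclic group of peripheral phases -/

/-- The group of phases of modulus one that are realized by a twisted symmetry. -/
def phaseGroup (A : Tensor d D) : Subgroup ℂˣ where
  carrier := {u | ‖(u : ℂ)‖ = 1 ∧ ∃ U, IsTwistedSymmetry A u U}
  mul_mem' := by
    rintro u v ⟨hu, U, hU⟩ ⟨hv, V, hV⟩
    exact ⟨by simp [hu, hv], U * V, by simpa using hU.mul hV⟩
  one_mem' := ⟨by simp, 1, by simpa using IsTwistedSymmetry.one A⟩
  inv_mem' := by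
    rintro u ⟨hu, U, hU⟩
    exact ⟨by simp [hu], star U, by simpa using hU.inv u.ne_zero⟩

theorem image_phaseGroup [NeZero D] (hA : IsCanonicalBlock A) :
    ((↑) : ℂˣ → ℂ) '' (phaseGroup A : Set ℂˣ) = peripheralEigenvalues A := by
  ext μ
  rw [mem_peripheralEigenvalues_iff hA]
  constructor
  · rintro ⟨u, hu, rfl⟩
    exact hu
  · intro h
    have h0 : μ ≠ 0 := by
      rintro rfl
      simp at h
    exact ⟨Units.mk0 μ h0, h, rfl⟩

/-- The peripheral eigenvalues are the powers of a primitive root of unity, and the corresponding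
twisted symmetry can be normalized so that its order divides their number. -/
theorem exists_primitiveRoot_twistedSymmetry [NeZero D] (hA : IsCanonicalBlock A) :
    0 < (peripheralEigenvalues A).ncard ∧ ∃ ω : ℂ, ‖ω‖ = 1 ∧
      IsPrimitiveRoot ω (peripheralEigenvalues A).ncard ∧
      ∃ U, IsTwistedSymmetry A ω U ∧ U ^ (peripheralEigenvalues A).ncard = 1 := by
  have hinj : Function.Injective ((↑) : ℂˣ → ℂ) := Units.val_injective
  have himg := image_phaseGroup hA
  have hcard : (peripheralEigenvalues A).ncard = Nat.card (phaseGroup A) := by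
    rw [← himg, Set.ncard_image_of_injective _ hinj, ← Nat.card_coe_set_eq]
    rfl
  have hfin : Finite (phaseGroup A) :=
    Set.Finite.of_finite_image (himg ▸ finite_peripheralEigenvalues A) hinj.injOn
  -- A finite subgroup of the units of a field is cyclic.
  obtain ⟨g, hg⟩ := IsCyclic.exists_generator (α := phaseGroup A)
  have hord : orderOf g = Nat.card (phaseGroup A) := orderOf_eq_card_of_forall_mem_zpowers hg
  rw [hcard]
  set p := Nat.card (phaseGroup A) with hp
  have hp0 : 0 < p := Nat.card_pos
  obtain ⟨hnorm, U, hU⟩ := g.2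
  have hprim : IsPrimitiveRoot ((g : ℂˣ) : ℂ) p := by
    rw [← hord, ← Subgroup.orderOf_coe, ← orderOf_units]
    exact IsPrimitiveRoot.orderOf _
  refine ⟨hp0, _, hnorm, hprim, ?_⟩
  have hfix := (hU.pow p).cpMap_eq hA.unital
  rw [hprim.pow_eq_one, one_smul] at hfix
  obtain ⟨c, hc⟩ := hA.fixed_unique _ hfix
  have hcc : star c * c = 1 := by
    have h := Unitary.star_mul_self_of_mem (hU.pow p).mem_unitary
    rw [hc] at h
    simpa [mul_comm] using congrFun (congrFun h 0) 0
  -- As `U ^ p = c • 1` with `‖c‖ = 1`, a `p`-th root `z` of `star c` has modulus one and `z • U`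
  -- has `p`-th power one.
  obtain ⟨z, hz⟩ := IsAlgClosed.exists_pow_nat_eq (star c) hp0
  have hznorm : star z * z = 1 := by
    have h1 : ‖c‖ = 1 := by
      have := congrArg norm hcc
      rw [norm_mul, norm_star, norm_one] at this
      nlinarith [norm_nonneg c]
    have h2 : ‖z‖ = 1 := by
      have := congrArg norm hz
      rw [norm_pow, norm_star, h1] at this
      exact (pow_eq_one_iff_of_nonneg (norm_nonneg z) hp0.ne').1 this
    rw [Complex.star_def, Complex.conj_mul', h2]; simp
  refine ⟨z • U, ⟨?_, fun i => ?_⟩, ?_⟩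
  · refine Matrix.mem_unitaryGroup_iff'.2 ?_
    rw [star_smul, Matrix.smul_mul, Matrix.mul_smul, smul_smul, hznorm, one_smul]
    exact Unitary.star_mul_self_of_mem hU.mem_unitary
  · rw [Matrix.mul_smul, hU.comm, Matrix.smul_mul, smul_comm]
  · rw [smul_pow, hc, hz, smul_smul, hcc, one_smul]

/-! ### Spectral projections of the twisted symmetry -/

/-- The spectral projection of `U`, with `U ^ p = 1`, for the eigenvalue `ω ^ k`. -/
noncomputable def spectralProjection (p : ℕ) (ω : ℂ) (U : Matrix (Fin D) (Fin D) ℂ) (k : ℕ) :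
    Matrix (Fin D) (Fin D) ℂ :=
  (p : ℂ)⁻¹ • ∑ j ∈ Finset.range p, (ω⁻¹ ^ k) ^ j • U ^ j

section SpectralProjection

variable {p : ℕ} {ω : ℂ} {U : Matrix (Fin D) (Fin D) ℂ}

theorem sum_range_pow_eq_of_pow_eq_one {M : Matrix (Fin D) (Fin D) ℂ} (hM : M ^ p = 1) :
    M * ∑ j ∈ Finset.range p, M ^ j = ∑ j ∈ Finset.range p, M ^ j := by
  have h := Finset.sum_range_succ (fun j => M ^ j) p
  rw [Finset.sum_range_succ'] at h
  rw [Finset.mul_sum]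
  simp only [← pow_succ']
  simpa [hM] using h

theorem mul_spectralProjection (hω : IsPrimitiveRoot ω p) (hp : 0 < p) (hU : U ^ p = 1) (k : ℕ) :
    U * spectralProjection p ω U k = ω ^ k • spectralProjection p ω U k := by
  have hω0 : ω ≠ 0 := hω.ne_zero hp.ne'
  have hM : ((ω⁻¹ ^ k) • U) ^ p = 1 := by
    rw [smul_pow, hU, ← pow_mul, mul_comm, pow_mul, inv_pow, hω.pow_eq_one]; simp
  have h := sum_range_pow_eq_of_pow_eq_one hM
  simp only [smul_pow] at h
  have hU' : U = ω ^ k • ((ω⁻¹ ^ k) • U) := by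
    rw [smul_smul, ← mul_pow, mul_inv_cancel₀ hω0, one_pow, one_smul]
  unfold spectralProjection
  rw [Matrix.mul_smul]
  conv_lhs => rw [hU', Matrix.smul_mul]
  rw [← hU', h, smul_comm]

theorem pow_mul_spectralProjection (hω : IsPrimitiveRoot ω p) (hp : 0 < p) (hU : U ^ p = 1)
    (k j : ℕ) :
    U ^ j * spectralProjection p ω U k = (ω ^ k) ^ j • spectralProjection p ω U k := by
  induction j with
  | zero => simp
  | succ j ih =>
    rw [pow_succ, mul_assoc, mul_spectralProjection hω hp hU, Matrix.mul_smul, ih, smul_smul,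
      pow_succ, mul_comm]

theorem spectralProjection_mul (hω : IsPrimitiveRoot ω p) (hp : 0 < p) (hU : U ^ p = 1)
    (k l : ℕ) :
    spectralProjection p ω U k * spectralProjection p ω U l =
      ((p : ℂ)⁻¹ * ∑ j ∈ Finset.range p, (ω⁻¹ ^ k * ω ^ l) ^ j) • spectralProjection p ω U l := by
  conv_lhs => enter [1]; unfold spectralProjection
  rw [Matrix.smul_mul, Finset.sum_mul]
  simp only [Matrix.smul_mul, pow_mul_spectralProjection hω hp hU, smul_smul, ← mul_pow]
  rw [← Finset.sum_smul, smul_smul]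

theorem spectralProjection_mul_self (hω : IsPrimitiveRoot ω p) (hp : 0 < p) (hU : U ^ p = 1)
    (k : ℕ) :
    spectralProjection p ω U k * spectralProjection p ω U k = spectralProjection p ω U k := by
  have hω0 : ω ≠ 0 := hω.ne_zero hp.ne'
  have hp0 : (p : ℂ) ≠ 0 := by exact_mod_cast hp.ne'
  rw [spectralProjection_mul hω hp hU, ← mul_pow, inv_mul_cancel₀ hω0]
  simp [hp0]

theorem spectralProjection_mul_of_ne (hω : IsPrimitiveRoot ω p) (hp : 0 < p) (hU : U ^ p = 1)
    {k l : ℕ} (hk : k < p) (hl : l < p) (hkl : k ≠ l) :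
    spectralProjection p ω U k * spectralProjection p ω U l = 0 := by
  have hω0 : ω ≠ 0 := hω.ne_zero hp.ne'
  have hne : ω⁻¹ ^ k * ω ^ l ≠ 1 := by
    intro h
    rw [inv_pow, inv_mul_eq_one₀ (pow_ne_zero _ hω0)] at h
    exact hkl (hω.pow_inj hk hl h)
  have hpow : (ω⁻¹ ^ k * ω ^ l) ^ p = 1 := by
    rw [mul_pow, ← pow_mul, ← pow_mul, mul_comm k, mul_comm l, pow_mul, pow_mul, inv_pow,
      hω.pow_eq_one]
    simp
  rw [spectralProjection_mul hω hp hU, geom_sum_eq hne, hpow]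
  simp

theorem spectralProjection_add_period (hω : IsPrimitiveRoot ω p) (k : ℕ) :
    spectralProjection p ω U (k + p) = spectralProjection p ω U k := by
  simp [spectralProjection, pow_add, hω.pow_eq_one]

theorem sum_spectralProjection (hω : IsPrimitiveRoot ω p) (hp : 0 < p) :
    ∑ k ∈ Finset.range p, spectralProjection p ω U k = 1 := by
  have hp0 : (p : ℂ) ≠ 0 := by exact_mod_cast hp.ne'
  unfold spectralProjection
  rw [← Finset.smul_sum, Finset.sum_comm]
  have key : ∀ j ∈ Finset.range p, ∑ k ∈ Finset.range p, (ω⁻¹ ^ k) ^ j • U ^ j =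
      if j = 0 then (p : ℂ) • (1 : Matrix (Fin D) (Fin D) ℂ) else 0 := by
    intro j hj
    rw [← Finset.sum_smul]
    split_ifs with h
    · simp [h]
    · have hne : ω⁻¹ ^ j ≠ 1 := by
        rw [inv_pow, Ne, inv_eq_one]
        exact hω.pow_ne_one_of_pos_of_lt h (Finset.mem_range.1 hj)
      simp only [← pow_mul, mul_comm _ j]
      simp only [pow_mul]
      rw [geom_sum_eq hne, ← pow_mul, mul_comm, pow_mul, inv_pow, hω.pow_eq_one]
      simp
  rw [Finset.sum_congr rfl key]
  simp [hp, hp0, smul_smul]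

theorem isHermitian_spectralProjection (hω : IsPrimitiveRoot ω p) (hp : 0 < p) (hU : U ^ p = 1)
    (hnorm : ‖ω‖ = 1) (hUmem : U ∈ unitary (Matrix (Fin D) (Fin D) ℂ)) (k : ℕ) :
    (spectralProjection p ω U k).IsHermitian := by
  set P := spectralProjection p ω U k with hP
  have hsU : star U * P = (ω⁻¹ ^ k) • P := by
    have h := congrArg (star U * ·) (mul_spectralProjection hω hp hU k)
    simp only [← mul_assoc, Unitary.star_mul_self_of_mem hUmem, one_mul, Matrix.mul_smul] at h
    rw [← hP] at h
    conv_rhs => rw [h]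
    rw [smul_smul, ← mul_pow, inv_mul_cancel₀ (hω.ne_zero hp.ne'), one_pow, one_smul]
  have hpow : ∀ j : ℕ, star U ^ j * P = (ω⁻¹ ^ k) ^ j • P := by
    intro j
    induction j with
    | zero => simp
    | succ j ih =>
      rw [pow_succ, mul_assoc, hsU, Matrix.mul_smul, ih, smul_smul, pow_succ, mul_comm]
  have hstar : star ω = ω⁻¹ := by
    rw [Complex.star_def, Complex.inv_eq_conj hnorm]
  have hp0 : (p : ℂ) ≠ 0 := by exact_mod_cast hp.ne'
  -- On the range of `P`, the operator `star U` acts as `ω⁻¹ ^ k`, so each of the `p` terms of `Pᴴ *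
  -- P` contributes `P`. Since `Pᴴ * P` is self-adjoint, so is `P`.
  have hPP : Pᴴ * P = P := by
    conv_lhs => enter [1]; rw [hP]; unfold spectralProjection
    simp only [Matrix.conjTranspose_smul, Matrix.conjTranspose_sum, Matrix.conjTranspose_pow,
      star_pow, star_inv₀, hstar, inv_inv]
    rw [Matrix.smul_mul, Finset.sum_mul]
    simp only [Matrix.smul_mul, ← Matrix.star_eq_conjTranspose, hpow, smul_smul, ← mul_pow,
      mul_inv_cancel₀ (hω.ne_zero hp.ne')]
    rw [← Finset.sum_smul, smul_smul]
    simp [hp0]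
  have := congrArg Matrix.conjTranspose hPP
  rw [Matrix.conjTranspose_mul, Matrix.conjTranspose_conjTranspose, hPP] at this
  exact this.symm

/-- Moving `A i` past `U ^ j` costs `ω ^ j`, which turns the coefficient `(ω⁻¹ ^ (k + 1)) ^ j` into
`(ω⁻¹ ^ k) ^ j`. -/
theorem mul_spectralProjection_succ (hω : IsPrimitiveRoot ω p) (hp : 0 < p)
    (hU : IsTwistedSymmetry A ω U) (i : Fin d) (k : ℕ) :
    A i * spectralProjection p ω U (k + 1) = spectralProjection p ω U k * A i := by
  unfold spectralProjection
  rw [Matrix.mul_smul, Matrix.smul_mul, Finset.mul_sum, Finset.sum_mul]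
  congr 1
  refine Finset.sum_congr rfl fun j _ => ?_
  rw [Matrix.mul_smul, (hU.pow j).comm, Matrix.smul_mul, smul_smul, ← mul_pow, pow_succ, mul_assoc,
    inv_mul_cancel₀ (hω.ne_zero hp.ne'), mul_one]

theorem isCyclicDecomposition_spectralProjection [NeZero D] (hA : ∑ i, A i * (A i)ᴴ = 1)
    (hω : IsPrimitiveRoot ω p) (hp : 0 < p) (hnorm : ‖ω‖ = 1) (hU : IsTwistedSymmetry A ω U)
    (hUp : U ^ p = 1) : IsCyclicDecomposition A p (spectralProjection p ω U) where
  periodic := spectralProjection_add_period hω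
  hermitian := isHermitian_spectralProjection hω hp hUp hnorm hU.mem_unitary
  idempotent := spectralProjection_mul_self hω hp hUp
  ne_zero := by
    -- If one projection vanishes, the shift relation and unitality kill its predecessor. Starting
    -- from `k + p` covers all indices below `p`, contradicting that the projections sum to one.
    have hstep : ∀ k, spectralProjection p ω U (k + 1) = 0 → spectralProjection p ω U k = 0 := by
      intro k hk
      have h : ∀ i, spectralProjection p ω U k * A i = 0 := fun i => by
        rw [← mul_spectralProjection_succ hω hp hU, hk, mul_zero]
      rw [← mul_one (spectralProjection p ω U k), ← hA, Finset.mul_sum]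
      exact Finset.sum_eq_zero fun i _ => by rw [← mul_assoc, h, zero_mul]
    have hle : ∀ m, spectralProjection p ω U m = 0 → ∀ k ≤ m, spectralProjection p ω U k = 0 := by
      intro m hm k hk
      exact Nat.decreasingInduction (motive := fun n _ => spectralProjection p ω U n = 0)
        (fun n _ h => hstep n h) hm hk
    intro k hk
    have hsum := sum_spectralProjection (U := U) hω hp
    rw [Finset.sum_eq_zero fun j hj => hle (k + p)
      ((spectralProjection_add_period hω k).trans hk) j (by have := Finset.mem_range.1 hj; omega)]
      at hsum
    exact zero_ne_one hsum
  orthogonal := fun _ hk _ hl hkl => spectralProjection_mul_of_ne hω hp hUp hk hl hkl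
  sum_eq_one := sum_spectralProjection hω hp
  shift := fun i k => mul_spectralProjection_succ hω hp hU i k

end SpectralProjection

/-! ### Block products, translation and the vanishing trace -/

section Blocks

variable {p : ℕ} {P : ℕ → Matrix (Fin D) (Fin D) ℂ} {M : Tensor d D}

/-- A product of block-restricted matrices is the restriction of the product. -/
theorem prod_ofFn_blocks (hshift : ∀ i k, M i * P (k + 1) = P k * M i)
    (hidem : ∀ k, P k * P k = P k) {N : ℕ} (i : Fin (N + 1) → Fin d) (k : ℕ) :
    (List.ofFn fun j : Fin (N + 1) => P (k + j) * M (i j) * P (k + j + 1)).prod =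
      P k * (List.ofFn fun j => M (i j)).prod := by
  -- The right-hand projection is redundant, since `M a` already maps between consecutive blocks.
  have hblock : ∀ a l, P l * M a * P (l + 1) = P l * M a := fun a l => by
    rw [mul_assoc, hshift, ← mul_assoc, hidem]
  simp only [hblock]
  induction N generalizing k with
  | zero => simp
  | succ N ih =>
    rw [List.ofFn_succ, List.ofFn_succ (f := fun j => M (i j)), List.prod_cons, List.prod_cons]
    have h := ih (fun j => i j.succ) (k + 1)
    have e : ∀ j : Fin (N + 1), k + (j.succ : ℕ) = k + 1 + j := fun j => by
      rw [Fin.val_succ]; omega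
    simp only [e, h, Fin.val_zero, add_zero]
    rw [← mul_assoc, mul_assoc (P k), hshift, ← mul_assoc, hidem, mul_assoc]

/-- Translation brings the last matrix to the front; pulling it left through `P k` produces `P (k +
1)`, and cyclicity of the trace returns it to the end. -/
theorem translation_blocks (hshift : ∀ i k, M i * P (k + 1) = P k * M i) {N : ℕ} (k : ℕ) :
    translation (WithLp.toLp 2 fun i : Fin (N + 1) → Fin d =>
      Matrix.trace (P k * (List.ofFn fun j => M (i j)).prod) : State d (N + 1)) =
    WithLp.toLp 2 fun i : Fin (N + 1) → Fin d =>
      Matrix.trace (P (k + 1) * (List.ofFn fun j => M (i j)).prod) := by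
  ext i
  simp only [translation]
  have h0 : (finRotate (N + 1)).symm 0 = Fin.last N := by
    rw [Equiv.symm_apply_eq, finRotate_last]
  have hs : ∀ j : Fin N, (finRotate (N + 1)).symm j.succ = j.castSucc := fun j => by
    rw [Equiv.symm_apply_eq, finRotate_apply, Fin.coeSucc_eq_succ]
  rw [List.ofFn_succ, List.ofFn_succ', List.concat_eq_append, List.prod_cons, List.prod_append]
  simp only [h0, hs, List.prod_singleton]
  rw [← mul_assoc, ← hshift, mul_assoc, Matrix.trace_mul_comm, mul_assoc]

theorem IsTwistedSymmetry.prod_mul {ω : ℂ} {U : Matrix (Fin D) (Fin D) ℂ}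
    (hU : IsTwistedSymmetry M ω U) (l : List (Fin d)) :
    (l.map M).prod * U = ω ^ l.length • (U * (l.map M).prod) := by
  induction l with
  | nil => simp
  | cons a l ih =>
    rw [List.map_cons, List.prod_cons, mul_assoc, ih, Matrix.mul_smul, ← mul_assoc, hU.comm,
      Matrix.smul_mul, smul_smul, mul_assoc, List.length_cons, pow_succ]

/-- Conjugation by `U` preserves the trace but multiplies the product by `ω ^ l.length`. -/
theorem IsTwistedSymmetry.trace_prod_eq_zero {ω : ℂ} {U : Matrix (Fin D) (Fin D) ℂ}
    (hU : IsTwistedSymmetry M ω U) (l : List (Fin d)) (hl : ω ^ l.length ≠ 1) :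
    Matrix.trace (l.map M).prod = 0 := by
  have h : Matrix.trace (l.map M).prod = ω ^ l.length * Matrix.trace (l.map M).prod := by
    calc Matrix.trace (l.map M).prod = Matrix.trace (star U * ((l.map M).prod * U)) := by
          rw [Matrix.trace_mul_comm, mul_assoc, Unitary.mul_star_self_of_mem hU.mem_unitary,
            mul_one]
      _ = _ := by
          rw [hU.prod_mul, Matrix.mul_smul, ← mul_assoc,
            Unitary.star_mul_self_of_mem hU.mem_unitary, one_mul, Matrix.trace_smul, smul_eq_mul]
  by_contra h0
  exact hl (mul_right_cancel₀ h0 (by rw [one_mul]; exact h.symm))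

end Blocks

end MPS

/-! ### Assembly of the decomposition -/

theorem theorem5 {d D N p : ℕ} (hN : 0 < N)
    (A : MPS.Tensor d D) (hA : MPS.IsCanonicalBlock A)
    (lam : ℝ) (hlam_pos : 0 < lam) (hlam_le : lam ≤ 1)
    (ψ : MPS.State d N) (hψ : ψ = MPS.tiMPS N fun i => (lam : ℂ) • A i)
    (hp : (MPS.peripheralEigenvalues A).ncard = p) :
    (p ∣ N →
      ∃ (φ : Fin p → MPS.State d N) (P : ℕ → Matrix (Fin D) (Fin D) ℂ),
        ψ = ∑ k, φ k ∧
        (∀ k, MPS.IsPeriodicState p (φ k)) ∧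
        (∀ k, MPS.HasMPSRepresentation D (φ k)) ∧
        MPS.IsCyclicDecomposition A p P ∧
        (∀ k : Fin p, φ k = MPS.mps fun (j : Fin N) (i : Fin d) =>
          P (k + j) * ((lam : ℂ) • A i) * P (k + j + 1))) ∧
    (¬ p ∣ N → ψ = 0) := by

  subst hψ
  -- For `D = 0` there are no eigenvectors, so `p = 0`, which does not divide the positive `N`; all
  -- traces are empty sums.
  rcases Nat.eq_zero_or_pos D with rfl | hD
  · refine ⟨fun h => ?_, fun _ => ?_⟩
    · have hp0 : p = 0 := by
        rw [← hp, Set.ncard_eq_zero (MPS.finite_peripheralEigenvalues A)]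
        refine Set.eq_empty_of_forall_notMem fun μ hμ => ?_
        obtain ⟨X, hX⟩ := hμ.1.exists_hasEigenvector
        exact hX.2 (Subsingleton.elim _ _)
      rw [hp0, zero_dvd_iff] at h
      omega
    · ext i
      simp [MPS.tiMPS, MPS.mps, Matrix.trace]
  have : NeZero D := ⟨hD.ne'⟩
  obtain ⟨hp0, ω, hnorm, hω, U, hU, hUp⟩ := MPS.exists_primitiveRoot_twistedSymmetry hA
  rw [hp] at hp0 hω hUp
  set M : MPS.Tensor d D := fun i => (lam : ℂ) • A i with hM
  have hUM : MPS.IsTwistedSymmetry M ω U :=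
    ⟨hU.mem_unitary, fun i => by
      simp only [hM, Matrix.smul_mul, Matrix.mul_smul, hU.comm, smul_comm ω]⟩
  refine ⟨fun hdvd => ?_, fun hndvd => ?_⟩
  · have hdec := MPS.isCyclicDecomposition_spectralProjection hA.unital hω hp0 hnorm hU hUp
    set P := MPS.spectralProjection p ω U
    have hshift : ∀ i k, M i * P (k + 1) = P k * M i := fun i k => by
      simp only [hM, Matrix.smul_mul, Matrix.mul_smul, hdec.shift]
    obtain ⟨n, rfl⟩ : ∃ n, N = n + 1 := ⟨N - 1, by omega⟩
    have hblocks : ∀ k : ℕ, MPS.mps (fun (j : Fin (n + 1)) (i : Fin d) =>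
        P (k + j) * M i * P (k + j + 1)) = WithLp.toLp 2 fun i : Fin (n + 1) → Fin d =>
          Matrix.trace (P k * (List.ofFn fun j => M (i j)).prod) := fun k => by
      simp only [MPS.mps, MPS.prod_ofFn_blocks hshift hdec.idempotent]
    refine ⟨fun k => MPS.mps fun (j : Fin (n + 1)) (i : Fin d) =>
        P (k + j) * M i * P (k + j + 1), P, ?_, fun k => ?_, fun k => ⟨_, rfl⟩, hdec,
        fun k => rfl⟩
    · simp only [hblocks]
      ext i
      simp only [MPS.tiMPS, MPS.mps, WithLp.ofLp_sum, Finset.sum_apply]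
      rw [← Matrix.trace_sum, ← Finset.sum_mul, Fin.sum_univ_eq_sum_range, hdec.sum_eq_one,
        one_mul]
    · have hiter : ∀ m : ℕ, MPS.translation^[m] (WithLp.toLp 2 fun i : Fin (n + 1) → Fin d =>
          Matrix.trace (P k * (List.ofFn fun j => M (i j)).prod)) =
          WithLp.toLp 2 fun i : Fin (n + 1) → Fin d =>
          Matrix.trace (P (k + m) * (List.ofFn fun j => M (i j)).prod) := fun m => by
        induction m with
        | zero => rfl
        | succ m ih =>
          rw [Function.iterate_succ_apply', ih, MPS.translation_blocks hshift, add_assoc]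
      -- After `p` translations the index is `k + p`, and `P (k + p) = P k`.
      simp only [MPS.IsPeriodicState, hblocks, hiter, hdec.periodic]
  · ext i
    have h := hUM.trace_prod_eq_zero (List.ofFn i) (by
      rw [List.length_ofFn, Ne, hω.pow_eq_one_iff_dvd]
      exact hndvd)
    rw [List.map_ofFn] at h
    exact h
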